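/- A \emph{relaxed binary tree} of size $n$ is obtained from a full binary (plane) tree with $n$ internal nodes and $n+1$ leaves as follows: the leaf that comes first in the post-order traversal is kept, and each of the other $n$ leaves is replaced by a pointer to some node (an internal node or the kept leaf) that the post-order traversal has visited before reaching that leaf. Its \emph{spine} consists of the $n$ internal nodes and the tree edges between them, and its \emph{right height} is the maximal number of right edges (edges to a right child) on a path in the spine from the root to a node of the spine ($0$ if $n=0$). Let $r_{k,n}$ be the number of relaxed binary trees of size $n$ with right height at most $k$, and let $$R_k(z)=\sum_{n\ge 0} r_{k,n}\frac{z^n}{n!}$$ be their exponential generating function, as a formal power series over $\mathbb{C}$. Let $D=\frac{d}{dz}$, let a polynomial in $z$ stand for the operator of multiplication by it, and let products of operators be compositions (so $D^2z\cdot F=(zF)''$). Define linear differential operators $(L_k)_{k\ge 0}$ by $$L_0=1-z,\qquad L_1=(1-2z)D-1,\qquad L_k=L_{k-1}\,D-L_{k-2}\,D^2z\quad(k\ge 2).$$ Then, for every $k\ge 1$, $$L_k\cdot R_k(z)=0 .$$ -/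

import Mathlib

namespace RelaxedBinaryTree

/-!
A binary tree is a `BinaryTree Unit`: the `node`s are its internal nodes and the `nil`s are the leaves of
the corresponding full binary tree.  A vertex (internal node or leaf) is addressed by the path that
leads to it from the root: `false` is an edge to the left child, `true` an edge to the right child.
-/

/-- `a` is the address of an internal node of `t`. -/
def IsInternal : BinaryTree Unit → List Bool → Prop
  | .nil, _ => False
  | .node _ _ _, [] => True
  | .node _ l _, false :: a => IsInternal l a
  | .node _ _ r, true :: a => IsInternal r a

/-- `a` is the address of a leaf of `t`. -/
def IsLeaf : BinaryTree Unit → List Bool → Prop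
  | .nil, [] => True
  | .nil, _ :: _ => False
  | .node _ _ _, [] => False
  | .node _ l _, false :: a => IsLeaf l a
  | .node _ _ r, true :: a => IsLeaf r a

/-- The addresses of all vertices of `t`, internal nodes and leaves, in post-order. -/
def postorder : BinaryTree Unit → List (List Bool)
  | .nil => [[]]
  | .node _ l r => (postorder l).map (false :: ·) ++ (postorder r).map (true :: ·) ++ [[]]

/-- In the post-order traversal of `t`, the vertex `a` is visited before the vertex `b`. -/
def VisitedBefore (t : BinaryTree Unit) (a b : List Bool) : Prop :=
  (postorder t).idxOf a < (postorder t).idxOf b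

/-- `a` is the leaf of `t` that the post-order traversal visits first. -/
def IsFirstLeaf (t : BinaryTree Unit) (a : List Bool) : Prop :=
  IsLeaf t a ∧ ∀ b, IsLeaf t b → b ≠ a → VisitedBefore t a b

/-- The right height: the maximal number of right edges on a path from the root to an internal node
of `t`, that is, to a node of the spine (it is `0` if there is no internal node). -/
noncomputable def rightHeight (t : BinaryTree Unit) : ℕ :=
  sSup {m | ∃ a, IsInternal t a ∧ m = a.count true}

/-- A relaxed binary tree: a binary tree in which the first leaf in post-order is kept and every
other leaf `a` is replaced by a pointer to a node (an internal node or the kept leaf) that has been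
visited before `a` by the post-order traversal. -/
structure RelaxedTree where
  /-- the underlying binary tree -/
  tree : BinaryTree Unit
  /-- the targets of the pointers -/
  pointer : (a : {a : List Bool // IsLeaf tree a ∧ ¬ IsFirstLeaf tree a}) →
    {b : List Bool // (IsInternal tree b ∨ IsFirstLeaf tree b) ∧ VisitedBefore tree b a.1}

/-- The number of relaxed trees with `n` internal nodes and right height at most `k`. -/
noncomputable def relaxedCount (k n : ℕ) : ℕ :=
  Nat.card {T : RelaxedTree // T.tree.numNodes = n ∧ rightHeight T.tree ≤ k}

/-- The exponential generating function of the relaxed trees of right height at most `k`. -/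
noncomputable def relaxedEGF (k : ℕ) : PowerSeries ℂ :=
  PowerSeries.mk fun n => (relaxedCount k n : ℂ) / (n.factorial : ℂ)

/-- The operator `d/dz` on power series. -/
noncomputable def opD : Module.End ℂ (PowerSeries ℂ) :=
  (PowerSeries.derivative ℂ).toLinearMap

/-- The operator of multiplication by `z`. -/
noncomputable def opZ : Module.End ℂ (PowerSeries ℂ) :=
  LinearMap.mulLeft ℂ PowerSeries.X

/-- The operators `L_k`; the product of operators is composition. -/
noncomputable def opL : ℕ → Module.End ℂ (PowerSeries ℂ)
  | 0 => 1 - opZ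
  | 1 => (1 - 2 * opZ) * opD - 1
  | k + 2 => opL (k + 1) * opD - opL k * (opD ^ 2 * opZ)

end RelaxedBinaryTree

/-!
Give a tree that starts after `m` nodes have been visited the weight counting the pointer choices of
all its leaves, and let `T k` be the linear operator sending `z ^ m / m!` to the exponential
generating function, in the number `N ≥ m` of nodes visited at the end, of the weighted trees whose
internal nodes have fewer than `k` right edges above them. Cutting a tree at its root gives a left
subtree of the same kind, a right subtree with one right edge less to spend, and then the root, so
`D T (k + 1) = D² z + T k T (k + 1)`. By induction this turns the recursion of the `L k` into
`L (k + 1) T (k + 2) = L k D² z`. Finally `R k = T (k + 1) 1` and `D² z 1 = 0`.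
-/

namespace RelaxedBinaryTree

open Finset

section General

theorem idxOf_map_of_injective {α β : Type*} [BEq α] [LawfulBEq α] [BEq β] [LawfulBEq β]
    {f : α → β} (hf : Function.Injective f) (l : List α) (a : α) :
    (l.map f).idxOf (f a) = l.idxOf a := by
  induction l with
  | nil => rfl
  | cons b l ih =>
    have h : (f b == f a) = (b == a) := by rw [Bool.eq_iff_iff, beq_iff_eq, beq_iff_eq, hf.eq_iff]
    rw [List.map_cons, List.idxOf_cons, List.idxOf_cons, ih, h]

theorem sum_antidiagonal_assoc {A M : Type*} [AddMonoid A] [HasAntidiagonal A] [AddCommMonoid M]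
    (f : A → A → A → M) (n : A) :
    ∑ p ∈ antidiagonal n, ∑ q ∈ antidiagonal p.1, f q.1 q.2 p.2 =
      ∑ p ∈ antidiagonal n, ∑ q ∈ antidiagonal p.2, f p.1 q.1 q.2 := by
  rw [sum_sigma', sum_sigma']
  refine sum_nbij' (fun x => ⟨(x.2.1, x.2.2 + x.1.2), (x.2.2, x.1.2)⟩)
    (fun x => ⟨(x.1.1 + x.2.1, x.2.2), (x.1.1, x.2.1)⟩) ?_ ?_ ?_ ?_ ?_ <;>
  · rintro ⟨⟨a, b⟩, c, d⟩ h
    simp only [mem_sigma, HasAntidiagonal.mem_antidiagonal] at h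
    obtain ⟨rfl, rfl⟩ := h
    simp [add_assoc]

theorem sum_treesOfNumNodesEq_succ {M : Type*} [AddCommMonoid M] (f : BinaryTree Unit → M)
    (n : ℕ) :
    ∑ t ∈ BinaryTree.treesOfNumNodesEq (n + 1), f t =
      ∑ p ∈ antidiagonal n, ∑ l ∈ BinaryTree.treesOfNumNodesEq p.1,
        ∑ r ∈ BinaryTree.treesOfNumNodesEq p.2, f (.node () l r) := by
  rw [BinaryTree.treesOfNumNodesEq_succ, sum_biUnion]
  · refine sum_congr rfl fun p _ => ?_
    rw [sum_map, sum_product]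
    rfl
  · simp_rw [Set.PairwiseDisjoint, Set.Pairwise, disjoint_left]
    aesop

end General

section Vertices

variable {u : Unit} {t l r : BinaryTree Unit} {a b : List Bool}

/-- The set of addresses of the internal nodes of `t`, as a `Finset`. -/
def internals : BinaryTree Unit → Finset (List Bool)
  | .nil => ∅
  | .node _ l r => insert [] ((internals l).image (false :: ·) ∪ (internals r).image (true :: ·))

/-- The set of addresses of the leaves of `t`, as a `Finset`. -/
def leaves : BinaryTree Unit → Finset (List Bool)
  | .nil => {[]}
  | .node _ l r => (leaves l).image (false :: ·) ∪ (leaves r).image (true :: ·)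

/-- The address of the leaf of `t` that is reached by left edges only. -/
def leftmostLeaf : BinaryTree Unit → List Bool
  | .nil => []
  | .node _ l _ => false :: leftmostLeaf l

theorem mem_internals : a ∈ internals t ↔ IsInternal t a := by
  induction t generalizing a with
  | nil => simp [internals, IsInternal]
  | node _ l r ihl ihr => rcases a with _ | ⟨_ | _, a⟩ <;> simp [internals, IsInternal, ihl, ihr]

theorem mem_leaves : a ∈ leaves t ↔ IsLeaf t a := by
  induction t generalizing a with
  | nil => cases a <;> simp [leaves, IsLeaf]
  | node _ l r ihl ihr => rcases a with _ | ⟨_ | _, a⟩ <;> simp [leaves, IsLeaf, ihl, ihr]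

theorem mem_postorder : a ∈ postorder t ↔ IsInternal t a ∨ IsLeaf t a := by
  induction t generalizing a with
  | nil => cases a <;> simp [postorder, IsInternal, IsLeaf]
  | node _ l r ihl ihr =>
    rcases a with _ | ⟨_ | _, a⟩ <;> simp [postorder, IsInternal, IsLeaf, ihl, ihr]

theorem IsInternal.mem_postorder (h : IsInternal t a) : a ∈ postorder t :=
  RelaxedBinaryTree.mem_postorder.2 (.inl h)

theorem IsLeaf.mem_postorder (h : IsLeaf t a) : a ∈ postorder t :=
  RelaxedBinaryTree.mem_postorder.2 (.inr h)

theorem IsInternal.not_isLeaf (h : IsInternal t a) : ¬ IsLeaf t a := by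
  induction t generalizing a with
  | nil => exact h.elim
  | node _ _ _ ihl ihr =>
    rcases a with _ | ⟨_ | _, a⟩
    · exact id
    · exact ihl h
    · exact ihr h

theorem card_internals (t : BinaryTree Unit) : #(internals t) = t.numNodes := by
  induction t with
  | nil => rfl
  | node _ l r ihl ihr =>
    rw [internals, card_insert_of_notMem (by simp),
      card_union_of_disjoint (by simp [disjoint_left]),
      card_image_of_injective _ List.cons_injective,
      card_image_of_injective _ List.cons_injective, ihl, ihr, BinaryTree.numNodes]

theorem isLeaf_leftmostLeaf (t : BinaryTree Unit) : IsLeaf t (leftmostLeaf t) := by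
  induction t with
  | nil => trivial
  | node _ _ _ ihl _ => exact ihl

theorem idxOf_postorder_left (ha : a ∈ postorder l) :
    (postorder (.node u l r)).idxOf (false :: a) = (postorder l).idxOf a := by
  rw [postorder, List.append_assoc, List.idxOf_append_of_mem (List.mem_map_of_mem ha),
    idxOf_map_of_injective List.cons_injective]

theorem idxOf_postorder_right (ha : a ∈ postorder r) :
    (postorder (.node u l r)).idxOf (true :: a) =
      (postorder l).length + (postorder r).idxOf a := by
  rw [postorder, List.append_assoc, List.idxOf_append_of_notMem (by simp),
    List.idxOf_append_of_mem (List.mem_map_of_mem ha),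
    idxOf_map_of_injective List.cons_injective, List.length_map]

theorem idxOf_postorder_root :
    (postorder (.node u l r)).idxOf [] = (postorder l).length + (postorder r).length := by
  rw [postorder, List.idxOf_append_of_notMem (by simp), List.idxOf_cons_self, List.length_append,
    List.length_map, List.length_map, add_zero]

theorem visitedBefore_left_left (ha : a ∈ postorder l) (hb : b ∈ postorder l) :
    VisitedBefore (.node u l r) (false :: a) (false :: b) ↔ VisitedBefore l a b := by
  rw [VisitedBefore, VisitedBefore, idxOf_postorder_left ha, idxOf_postorder_left hb]

theorem visitedBefore_right_right (ha : a ∈ postorder r) (hb : b ∈ postorder r) :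
    VisitedBefore (.node u l r) (true :: a) (true :: b) ↔ VisitedBefore r a b := by
  rw [VisitedBefore, VisitedBefore, idxOf_postorder_right ha, idxOf_postorder_right hb,
    Nat.add_lt_add_iff_left]

theorem visitedBefore_left_right (ha : a ∈ postorder l) (hb : b ∈ postorder r) :
    VisitedBefore (.node u l r) (false :: a) (true :: b) := by
  rw [VisitedBefore, idxOf_postorder_left ha, idxOf_postorder_right hb]
  exact Nat.lt_add_right _ (List.idxOf_lt_length_of_mem ha)

theorem not_visitedBefore_right_left (ha : a ∈ postorder r) (hb : b ∈ postorder l) :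
    ¬ VisitedBefore (.node u l r) (true :: a) (false :: b) :=
  (visitedBefore_left_right hb ha).not_gt

theorem not_visitedBefore_root (hb : b ∈ postorder (.node u l r)) :
    ¬ VisitedBefore (.node u l r) [] b := by
  have := List.idxOf_lt_length_of_mem hb
  simp only [postorder, List.length_append, List.length_map, List.length_singleton] at this
  rw [VisitedBefore, idxOf_postorder_root, postorder]
  omega

theorem idxOf_leftmostLeaf (t : BinaryTree Unit) : (postorder t).idxOf (leftmostLeaf t) = 0 := by
  induction t with
  | nil => rfl
  | node _ l r ihl _ =>
    rw [leftmostLeaf, idxOf_postorder_left (isLeaf_leftmostLeaf l).mem_postorder, ihl]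

theorem not_visitedBefore_leftmostLeaf : ¬ VisitedBefore t a (leftmostLeaf t) := by
  simp [VisitedBefore, idxOf_leftmostLeaf]

theorem visitedBefore_of_ne_leftmostLeaf (hne : a ≠ leftmostLeaf t) :
    VisitedBefore t (leftmostLeaf t) a := by
  have h : (postorder t).idxOf (leftmostLeaf t) ≠ (postorder t).idxOf a := fun h =>
    hne ((List.idxOf_inj (isLeaf_leftmostLeaf t).mem_postorder).1 h).symm
  rw [idxOf_leftmostLeaf] at h
  rw [VisitedBefore, idxOf_leftmostLeaf]
  exact Nat.pos_of_ne_zero h.symm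

theorem isFirstLeaf_iff : IsFirstLeaf t a ↔ a = leftmostLeaf t := by
  constructor
  · rintro ⟨-, h⟩
    by_contra hne
    exact not_visitedBefore_leftmostLeaf (h _ (isLeaf_leftmostLeaf t) (Ne.symm hne))
  · rintro rfl
    exact ⟨isLeaf_leftmostLeaf t, fun b _ hne => visitedBefore_of_ne_leftmostLeaf hne⟩

end Vertices

section Pointers

variable {u : Unit} {t l r : BinaryTree Unit} {a b : List Bool}

instance (t : BinaryTree Unit) : DecidableRel (VisitedBefore t) :=
  fun _ _ => inferInstanceAs (Decidable (_ < _))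

/-- The internal nodes of `t` that are visited before `a`: together with the kept leaf, the possible
targets of a pointer at `a`. -/
def internalsBefore (t : BinaryTree Unit) (a : List Bool) : Finset (List Bool) :=
  (internals t).filter (VisitedBefore t · a)

theorem mem_internalsBefore : b ∈ internalsBefore t a ↔ IsInternal t b ∧ VisitedBefore t b a := by
  rw [internalsBefore, mem_filter, mem_internals]

theorem internalsBefore_leftmostLeaf (t : BinaryTree Unit) :
    internalsBefore t (leftmostLeaf t) = ∅ :=
  filter_eq_empty_iff.2 fun _ _ => not_visitedBefore_leftmostLeaf

theorem internalsBefore_left (ha : IsLeaf l a) :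
    internalsBefore (.node u l r) (false :: a) = (internalsBefore l a).image (false :: ·) := by
  ext b
  rw [mem_internalsBefore]
  rcases b with _ | ⟨_ | _, b⟩
  · have : ¬ VisitedBefore (.node u l r) [] (false :: a) :=
      not_visitedBefore_root (IsLeaf.mem_postorder (t := .node u l r) ha)
    simp [this]
  · simpa [mem_internalsBefore, IsInternal] using fun hb : IsInternal l b =>
      visitedBefore_left_left hb.mem_postorder ha.mem_postorder
  · simpa [IsInternal] using fun hb : IsInternal r b =>
      not_visitedBefore_right_left hb.mem_postorder ha.mem_postorder

theorem internalsBefore_right (ha : IsLeaf r a) :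
    internalsBefore (.node u l r) (true :: a) =
      (internals l).image (false :: ·) ∪ (internalsBefore r a).image (true :: ·) := by
  ext b
  rw [mem_internalsBefore]
  rcases b with _ | ⟨_ | _, b⟩
  · have : ¬ VisitedBefore (.node u l r) [] (true :: a) :=
      not_visitedBefore_root (IsLeaf.mem_postorder (t := .node u l r) ha)
    simp [this]
  · simpa [mem_internals, IsInternal] using fun hb : IsInternal l b =>
      visitedBefore_left_right hb.mem_postorder ha.mem_postorder
  · simpa [mem_internalsBefore, IsInternal] using fun hb : IsInternal r b =>
      visitedBefore_right_right hb.mem_postorder ha.mem_postorder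

/-- The number of ways to choose the pointers of all leaves of `t`, the first included, if `t` is
part of a larger traversal in which the kept leaf and `m` internal nodes come before `t`. -/
def weight (t : BinaryTree Unit) (m : ℕ) : ℕ :=
  ∏ a ∈ leaves t, (m + #(internalsBefore t a) + 1)

theorem weight_pos (t : BinaryTree Unit) (m : ℕ) : 0 < weight t m :=
  prod_pos fun _ _ => Nat.succ_pos _

theorem weight_nil (m : ℕ) : weight .nil m = m + 1 := by
  simp [weight, leaves, internalsBefore, internals]

theorem weight_node (m : ℕ) :
    weight (.node u l r) m = weight l m * weight r (m + l.numNodes) := by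
  rw [weight, leaves, prod_union (by simp [disjoint_left]),
    prod_image List.cons_injective.injOn, prod_image List.cons_injective.injOn]
  congr 1
  · refine prod_congr rfl fun a ha => ?_
    rw [internalsBefore_left (mem_leaves.1 ha), card_image_of_injective _ List.cons_injective]
  · refine prod_congr rfl fun a ha => ?_
    rw [internalsBefore_right (mem_leaves.1 ha),
      card_union_of_disjoint (by simp [disjoint_left]),
      card_image_of_injective _ List.cons_injective,
      card_image_of_injective _ List.cons_injective, card_internals, add_assoc m l.numNodes]

/-- The choices of pointers that make `t` a relaxed tree: the type of `RelaxedTree.pointer`. -/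
abbrev Pointers (t : BinaryTree Unit) : Type :=
  (a : {a : List Bool // IsLeaf t a ∧ ¬ IsFirstLeaf t a}) →
    {b : List Bool // (IsInternal t b ∨ IsFirstLeaf t b) ∧ VisitedBefore t b a.1}

theorem card_targets (hne : a ≠ leftmostLeaf t) :
    Nat.card {b : List Bool // (IsInternal t b ∨ IsFirstLeaf t b) ∧ VisitedBefore t b a} =
      #(internalsBefore t a) + 1 := by
  have hnot : leftmostLeaf t ∉ internalsBefore t a := fun h =>
    (mem_internalsBefore.1 h).1.not_isLeaf (isLeaf_leftmostLeaf t)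
  rw [← card_insert_of_notMem hnot]
  refine Nat.subtype_card _ fun b => ?_
  rw [mem_insert, mem_internalsBefore, isFirstLeaf_iff]
  constructor
  · rintro (rfl | ⟨hb, hba⟩)
    · exact ⟨.inr rfl, visitedBefore_of_ne_leftmostLeaf hne⟩
    · exact ⟨.inl hb, hba⟩
  · rintro ⟨hb | hb, hba⟩
    · exact .inr ⟨hb, hba⟩
    · exact .inl hb

theorem card_pointers (t : BinaryTree Unit) : Nat.card (Pointers t) = weight t 0 := by
  have hmem (a : List Bool) :
      a ∈ (leaves t).erase (leftmostLeaf t) ↔ IsLeaf t a ∧ ¬ IsFirstLeaf t a := by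
    rw [mem_erase, mem_leaves, isFirstLeaf_iff, and_comm]
  let _ : Fintype {a : List Bool // IsLeaf t a ∧ ¬ IsFirstLeaf t a} := Fintype.subtype _ hmem
  calc
    Nat.card (Pointers t)
      = ∏ a : {a : List Bool // IsLeaf t a ∧ ¬ IsFirstLeaf t a}, (#(internalsBefore t a) + 1) := by
        rw [Nat.card_pi]
        exact prod_congr rfl fun a _ => card_targets (mt isFirstLeaf_iff.2 a.2.2)
    _ = ∏ a ∈ (leaves t).erase (leftmostLeaf t), (#(internalsBefore t a) + 1) :=
        (prod_subtype _ hmem fun a => #(internalsBefore t a) + 1).symm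
    _ = ∏ a ∈ leaves t, (#(internalsBefore t a) + 1) :=
        prod_erase _ (by rw [internalsBefore_leftmostLeaf, card_empty, zero_add])
    _ = weight t 0 := by simp only [weight, zero_add]

theorem card_relaxedTree_mem (S : Finset (BinaryTree Unit)) :
    Nat.card {T : RelaxedTree // T.tree ∈ S} = ∑ t ∈ S, weight t 0 := by
  let e : {T : RelaxedTree // T.tree ∈ S} ≃ Σ t : S, Pointers t.1 :=
    { toFun T := ⟨⟨T.1.tree, T.2⟩, T.1.pointer⟩
      invFun p := ⟨⟨p.1.1, p.2⟩, p.1.2⟩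
      left_inv _ := rfl
      right_inv _ := rfl }
  have (t : S) : Finite (Pointers t.1) :=
    Nat.finite_of_card_ne_zero (by rw [card_pointers]; exact (weight_pos _ _).ne')
  rw [Nat.card_congr e, Nat.card_sigma]
  simp only [card_pointers]
  exact sum_coe_sort S fun t => weight t 0

end Pointers

section RightHeight

variable {u : Unit} {t l r : BinaryTree Unit} {k : ℕ}

/-- Every internal node of `t` has fewer than `k` right edges above it. Unlike `rightHeight t < k`,
this holds for `k = 0` if `t` has no internal node, so that it is compatible with the decomposition
of a tree at its root. -/
def RightHeightLT (t : BinaryTree Unit) (k : ℕ) : Prop :=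
  ∀ a, IsInternal t a → a.count true < k

theorem rightHeightLT_nil (k : ℕ) : RightHeightLT .nil k :=
  fun _ h => h.elim

theorem not_rightHeightLT_node_zero : ¬ RightHeightLT (.node u l r) 0 :=
  fun h => Nat.not_lt_zero _ (h [] trivial)

theorem rightHeightLT_node_succ :
    RightHeightLT (.node u l r) (k + 1) ↔ RightHeightLT l (k + 1) ∧ RightHeightLT r k := by
  refine ⟨fun h => ⟨fun a ha => ?_, fun a ha => ?_⟩, fun ⟨hl, hr⟩ a ha => ?_⟩
  · simpa using h (false :: a) ha
  · simpa using h (true :: a) ha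
  · rcases a with _ | ⟨_ | _, a⟩
    · exact Nat.succ_pos k
    · simpa using hl a ha
    · simpa using hr a ha

theorem rightHeight_le_iff : rightHeight t ≤ k ↔ RightHeightLT t (k + 1) := by
  have hbdd : BddAbove {m | ∃ a, IsInternal t a ∧ m = a.count true} := by
    refine (((internals t).finite_toSet.image (·.count true)).subset ?_).bddAbove
    rintro _ ⟨a, ha, rfl⟩
    exact Set.mem_image_of_mem _ (mem_internals.2 ha)
  constructor
  · exact fun h a ha => Nat.lt_succ_of_le ((le_csSup hbdd ⟨a, ha, rfl⟩).trans h)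
  · intro h
    refine csSup_le' ?_
    rintro _ ⟨a, ha, rfl⟩
    exact Nat.le_of_lt_succ (h a ha)

end RightHeight

section WeightedCount

open Classical in
/-- The total weight of the trees with `n` internal nodes, each of which has fewer than `k` right
edges above it, if `m` internal nodes have been visited before. -/
noncomputable def weightedCount (k m n : ℕ) : ℕ :=
  ∑ t ∈ BinaryTree.treesOfNumNodesEq n with RightHeightLT t k, weight t m

theorem relaxedCount_eq_weightedCount (k n : ℕ) : relaxedCount k n = weightedCount (k + 1) 0 n := by
  rw [weightedCount, ← card_relaxedTree_mem]
  simp only [relaxedCount, mem_filter, BinaryTree.mem_treesOfNumNodesEq, rightHeight_le_iff]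

theorem weightedCount_nodes_zero (k m : ℕ) : weightedCount k m 0 = m + 1 := by
  simp [weightedCount, sum_filter, rightHeightLT_nil, weight_nil]

theorem weightedCount_zero_succ (m n : ℕ) : weightedCount 0 m (n + 1) = 0 := by
  simp [weightedCount, sum_filter, sum_treesOfNumNodesEq_succ, not_rightHeightLT_node_zero]

theorem weightedCount_succ_succ (k m n : ℕ) :
    weightedCount (k + 1) m (n + 1) =
      ∑ p ∈ antidiagonal n, weightedCount (k + 1) m p.1 * weightedCount k (m + p.1) p.2 := by
  simp only [weightedCount, sum_filter]
  rw [sum_treesOfNumNodesEq_succ]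
  refine sum_congr rfl fun p _ => ?_
  rw [sum_mul_sum]
  refine sum_congr rfl fun l hl => sum_congr rfl fun r _ => ?_
  rw [rightHeightLT_node_succ, weight_node, BinaryTree.mem_treesOfNumNodesEq.1 hl,
    ite_zero_mul_ite_zero]
  congr

end WeightedCount

section EGF

/-- The `n`-th coefficient of `F` as an exponential generating function. -/
noncomputable def egfCoeff (n : ℕ) : PowerSeries ℂ →ₗ[ℂ] ℂ :=
  (n.factorial : ℂ) • PowerSeries.coeff n

theorem egfCoeff_apply (n : ℕ) (F : PowerSeries ℂ) :
    egfCoeff n F = n.factorial * PowerSeries.coeff n F :=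
  rfl

theorem egfCoeff_mk_div_factorial (f : ℕ → ℂ) (n : ℕ) :
    egfCoeff n (PowerSeries.mk fun i => f i / i.factorial) = f n := by
  rw [egfCoeff_apply, PowerSeries.coeff_mk, mul_div_cancel₀]
  exact_mod_cast n.factorial_ne_zero

theorem ext_egfCoeff {F G : PowerSeries ℂ} (h : ∀ n, egfCoeff n F = egfCoeff n G) : F = G := by
  ext n
  exact mul_left_cancel₀ (by exact_mod_cast n.factorial_ne_zero) (h n)

theorem egfCoeff_opD (n : ℕ) (F : PowerSeries ℂ) : egfCoeff n (opD F) = egfCoeff (n + 1) F := by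
  change _ * PowerSeries.coeff n (PowerSeries.derivative ℂ F) = _
  rw [PowerSeries.coeff_derivative, egfCoeff_apply, Nat.factorial_succ]
  push_cast
  ring

theorem egfCoeff_succ_opZ (n : ℕ) (F : PowerSeries ℂ) :
    egfCoeff (n + 1) (opZ F) = (n + 1) * egfCoeff n F := by
  change _ * PowerSeries.coeff (n + 1) (PowerSeries.X * F) = _
  rw [PowerSeries.coeff_succ_X_mul, egfCoeff_apply, Nat.factorial_succ]
  push_cast
  ring

theorem egfCoeff_one_of_ne_zero {n : ℕ} (hn : n ≠ 0) : egfCoeff n 1 = 0 := by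
  rw [egfCoeff_apply, PowerSeries.coeff_one, if_neg hn, mul_zero]

end EGF

section Transfer

/-- The operator sending `z ^ m / m!` to `∑ n, weightedCount k m n * z ^ (m + n) / (m + n)!`: it
inserts, after the nodes that have already been visited, a weighted tree whose internal nodes have
fewer than `k` right edges above them. -/
noncomputable def transfer (k : ℕ) : Module.End ℂ (PowerSeries ℂ) where
  toFun F := .mk fun N =>
    (∑ p ∈ antidiagonal N, egfCoeff p.1 F * weightedCount k p.1 p.2) / N.factorial
  map_add' F G := by
    refine ext_egfCoeff fun N => ?_
    simp only [map_add, egfCoeff_mk_div_factorial, add_mul, sum_add_distrib]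
  map_smul' c F := by
    refine ext_egfCoeff fun N => ?_
    simp only [map_smul, egfCoeff_mk_div_factorial, smul_eq_mul, mul_assoc, mul_sum,
      RingHom.id_apply]

theorem egfCoeff_transfer (k N : ℕ) (F : PowerSeries ℂ) :
    egfCoeff N (transfer k F) = ∑ p ∈ antidiagonal N, egfCoeff p.1 F * weightedCount k p.1 p.2 :=
  egfCoeff_mk_div_factorial _ N

theorem relaxedEGF_eq_transfer_one (k : ℕ) : relaxedEGF k = transfer (k + 1) 1 := by
  refine ext_egfCoeff fun N => ?_
  rw [relaxedEGF, egfCoeff_mk_div_factorial, egfCoeff_transfer, sum_eq_single (0, N),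
    relaxedCount_eq_weightedCount]
  · simp [egfCoeff_apply]
  · rintro ⟨i, j⟩ hij hne
    have hi : i ≠ 0 := by
      rintro rfl
      simp_all
    rw [egfCoeff_one_of_ne_zero hi, zero_mul]
  · simp

theorem transfer_zero : transfer 0 = opD * opZ := by
  refine LinearMap.ext fun F => ext_egfCoeff fun N => ?_
  rw [Module.End.mul_apply, egfCoeff_opD, egfCoeff_succ_opZ, egfCoeff_transfer,
    sum_eq_single (N, 0)]
  · rw [weightedCount_nodes_zero, Nat.cast_succ, mul_comm]
  · rintro ⟨i, _ | j⟩ hij hne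
    · simp_all
    · rw [weightedCount_zero_succ, Nat.cast_zero, mul_zero]
  · simp

theorem constantCoeff_transfer (k : ℕ) (F : PowerSeries ℂ) :
    PowerSeries.constantCoeff (transfer k F) = PowerSeries.constantCoeff F := by
  simpa [egfCoeff_apply, weightedCount_nodes_zero] using egfCoeff_transfer k 0 F

theorem opD_mul_transfer_succ (k : ℕ) :
    opD * transfer (k + 1) = opD ^ 2 * opZ + transfer k * transfer (k + 1) := by
  refine LinearMap.ext fun F => ext_egfCoeff fun N => ?_
  have hnil : egfCoeff N ((opD ^ 2 * opZ) F) =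
      egfCoeff (N + 1) F * weightedCount (k + 1) (N + 1) 0 := by
    rw [pow_two, Module.End.mul_apply, Module.End.mul_apply, egfCoeff_opD, egfCoeff_opD,
      egfCoeff_succ_opZ, weightedCount_nodes_zero, Nat.cast_succ (N + 1), mul_comm]
  have hnode : egfCoeff N (transfer k (transfer (k + 1) F)) =
      ∑ p ∈ antidiagonal N, egfCoeff p.1 F * weightedCount (k + 1) p.1 (p.2 + 1) := by
    rw [egfCoeff_transfer]
    simp only [weightedCount_succ_succ, Nat.cast_sum, Nat.cast_mul, mul_sum, ← mul_assoc]
    rw [← sum_antidiagonal_assoc fun i j l => egfCoeff i F * (weightedCount (k + 1) i j : ℂ) *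
      (weightedCount k (i + j) l : ℂ)]
    refine sum_congr rfl fun p _ => ?_
    rw [egfCoeff_transfer, sum_mul]
    exact sum_congr rfl fun q hq => by rw [mem_antidiagonal.1 hq]
  calc
    egfCoeff N (opD (transfer (k + 1) F))
      = egfCoeff (N + 1) F * weightedCount (k + 1) (N + 1) 0 +
          ∑ p ∈ antidiagonal N, egfCoeff p.1 F * weightedCount (k + 1) p.1 (p.2 + 1) := by
        rw [egfCoeff_opD, egfCoeff_transfer, Nat.sum_antidiagonal_succ']
    _ = egfCoeff N ((opD ^ 2 * opZ) F + transfer k (transfer (k + 1) F)) := by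
        rw [map_add, hnil, hnode]

end Transfer

section Annihilation

theorem opD_mul_opZ : opD * opZ = 1 + opZ * opD := by
  refine LinearMap.ext fun F => ?_
  change PowerSeries.derivative ℂ (PowerSeries.X * F) =
    F + PowerSeries.X * PowerSeries.derivative ℂ F
  simp [Derivation.leibniz, add_comm]

theorem opL_one : opL 1 = opL 0 * opD - opD * opZ := by
  rw [opL, opL, opD_mul_opZ, two_mul, sub_mul, sub_mul, add_mul]
  abel

theorem opL_zero_mul_transfer_one : opL 0 * transfer 1 = opD * opZ := by
  have hderiv : opD * (opL 0 * transfer 1) = opD * (opD * opZ) := by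
    calc
      opD * (opL 0 * transfer 1) = opD * transfer 1 - opD * opZ * transfer 1 := by
        rw [opL, sub_mul, one_mul, mul_sub, mul_assoc]
      _ = opD * (opD * opZ) := by
        rw [opD_mul_transfer_succ, transfer_zero, add_sub_cancel_right, pow_two, mul_assoc]
  refine LinearMap.ext fun F => PowerSeries.derivative.ext (LinearMap.congr_fun hderiv F) ?_
  rw [opD_mul_opZ]
  simp [opL, opZ, constantCoeff_transfer]

theorem opL_succ_mul_transfer (k : ℕ) :
    opL (k + 1) * transfer (k + 2) = opL k * (opD ^ 2 * opZ) := by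
  induction k with
  | zero =>
    calc
      opL 1 * transfer 2 = opL 0 * (opD * transfer 2) - opD * opZ * transfer 2 := by
        rw [opL_one, sub_mul, mul_assoc]
      _ = opL 0 * (opD ^ 2 * opZ) := by
        rw [opD_mul_transfer_succ, mul_add, ← mul_assoc _ (transfer 1),
          opL_zero_mul_transfer_one, add_sub_cancel_right]
  | succ k ih =>
    calc
      opL (k + 2) * transfer (k + 3)
        = opL (k + 1) * (opD * transfer (k + 3)) - opL k * (opD ^ 2 * opZ) * transfer (k + 3) := by
          rw [opL, sub_mul, mul_assoc]
      _ = opL (k + 1) * (opD ^ 2 * opZ) := by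
          rw [opD_mul_transfer_succ, mul_add, ← mul_assoc _ (transfer (k + 2)), ih,
            add_sub_cancel_right]

theorem opD_one : opD 1 = 0 :=
  PowerSeries.derivative_one

theorem opD_sq_mul_opZ_one : (opD ^ 2 * opZ) 1 = 0 := by
  rw [pow_two, mul_assoc, opD_mul_opZ]
  simp only [Module.End.mul_apply, LinearMap.add_apply, Module.End.one_apply, opD_one, map_zero,
    add_zero]

end Annihilation

end RelaxedBinaryTree

theorem theorem7p4 (k : ℕ) (hk : 1 ≤ k) :
    RelaxedBinaryTree.opL k (RelaxedBinaryTree.relaxedEGF k) = 0 := by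
  obtain ⟨k, rfl⟩ := Nat.exists_eq_add_of_le' hk
  rw [RelaxedBinaryTree.relaxedEGF_eq_transfer_one]
  calc
    RelaxedBinaryTree.opL (k + 1) (RelaxedBinaryTree.transfer (k + 2) 1)
      = RelaxedBinaryTree.opL k ((RelaxedBinaryTree.opD ^ 2 * RelaxedBinaryTree.opZ) 1) :=
        LinearMap.congr_fun (RelaxedBinaryTree.opL_succ_mul_transfer k) 1
    _ = 0 := by rw [RelaxedBinaryTree.opD_sq_mul_opZ_one, map_zero]
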